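/- For $\nu\in\{0,1\}$ let $I_\nu(z)=\sum_{k\ge0}\frac{1}{k!\,(k+\nu)!}\left(\frac z2\right)^{2k+\nu}$ be the modified Bessel function of the first kind and let $J_\nu(z)=\sum_{k\ge0}\frac{(-1)^k}{k!\,(k+\nu)!}\left(\frac z2\right)^{2k+\nu}$ be the Bessel function of the first kind. Let $0<j_{1,1}<j_{1,2}<\cdots$ be the positive zeros of $J_1$ and, for real $p>1$, let $\zeta_1(p)=\sum_{n=1}^{\infty}j_{1,n}^{-p}$ be the Bessel zeta function. **Theorem.** There is a convergent power series expansion $$x\left(\frac{\sqrt x\,I_0(2\sqrt x)}{I_1(2\sqrt x)}-2\right)=\sum_{k=1}^{\infty}a_kx^k$$ for all complex $x$ in a neighbourhood of $0$ (the left side being given its limit value $0$ at $x=0$; it does not depend on the choice of $\sqrt x$). With its coefficients $a_k$, put $M_k=(-1)^{k+1}(k+1)!\,k!\,a_{k+1}$. Then for every integer $k\ge1$ the series $\zeta_1(2k)$ converges and $$M_k=k!\,(k+1)!\,2^{2k}\,\zeta_1(2k).$$ -/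

import Mathlib

open Filter Topology
open scoped Nat

/-- The modified Bessel function of the first kind `I_ν`, for a natural order `ν`. -/
noncomputable def besselI (ν : ℕ) (z : ℂ) : ℂ :=
  ∑' k : ℕ, 1 / ((k ! : ℂ) * ((k + ν)! : ℂ)) * (z / 2) ^ (2 * k + ν)

/-- The Bessel function of the first kind `J_ν`, for a natural order `ν`, on the real line. -/
noncomputable def besselJ (ν : ℕ) (x : ℝ) : ℝ :=
  ∑' k : ℕ, (-1) ^ k / ((k ! : ℝ) * ((k + ν)! : ℝ)) * (x / 2) ^ (2 * k + ν)

/-- For `k ≥ 1`, `besselZero ν k` is the `k`-th positive zero `j_{ν,k}` of `J_ν`, in increasing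
order: the first zero of `J_ν` beyond `j_{ν,k-1}`, where `j_{ν,0} = 0` only starts the
recursion. -/
noncomputable def besselZero (ν : ℕ) : ℕ → ℝ
  | 0 => 0
  | k + 1 => sInf {x : ℝ | besselZero ν k < x ∧ besselJ ν x = 0}

/-- The Bessel zeta function `ζ_ν(p) = ∑_{k ≥ 1} 1 / j_{ν,k}^p`, meant for real `p > 1`. -/
noncomputable def besselZeta (ν : ℕ) (p : ℝ) : ℝ :=
  ∑' k : ℕ, 1 / besselZero ν (k + 1) ^ p

/-- The function `x (√x I₀(2√x) / I₁(2√x) - 2)`. Both `√x I₀(2√x)` and `I₁(2√x)` change sign with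
`√x`, so the choice of the square root is immaterial. At `x = 0` the value is `0`, which is
also the limit there. -/
noncomputable def benderFun (x : ℂ) : ℂ :=
  x * (x ^ (1 / 2 : ℂ) * besselI 0 (2 * x ^ (1 / 2 : ℂ)) / besselI 1 (2 * x ^ (1 / 2 : ℂ)) - 2)

/-- The numbers `a_k`, `k ≥ 1`, are the coefficients in
`x (√x I₀(2√x) / I₁(2√x) - 2) = ∑_{k ≥ 1} a_k x^k`, valid for all `x` near `0`
(the value `a 0` plays no role). -/
def IsBenderExpansion (a : ℕ → ℂ) : Prop :=
  ∀ᶠ x in 𝓝 (0 : ℂ), HasSum (fun k : ℕ => a (k + 1) * x ^ (k + 1)) (benderFun x)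

/-- `M_k = (-1)^{k+1} (k+1)! k! a_{k+1}`. -/
def benderM (a : ℕ → ℂ) (k : ℕ) : ℂ :=
  (-1) ^ (k + 1) * ((k + 1)! : ℂ) * (k ! : ℂ) * a (k + 1)

/-! Since `J_1(z) = (z/2) G_1(-z²/4)`, the zeros of `G_1` should be exactly the simple points
`-j_{1,n}²/4`, and `G_0 = G_1 + x G_1'` turns the left side into `x (-1 + x G_1'/G_1)`. Formally
`G_1'/G_1 = ∑ 1/(x + j_{1,n}²/4)`, so `a_{k+2} = (-1)^k 4^{k+1} ζ_1(2k+2)`.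

The partial fractions are justified coefficientwise, without Hadamard's theorem. `G_1` grows at most
like `exp(2√|z|)` (`norm_besselSeries_le`). Dividing out the zeros in `|z| < R` leaves a zero-free
factor `exp h`; Borel–Carathéodory and Cauchy give `h^{(k+1)}(0) = O(R^{1/2-(k+1)})`
(`norm_sum_inv_pow_add_le`). With `R = j_{1,N+1}²/4 → ∞` this vanishes in the limit for every `k ≥
0`.

Two facts about zeros are also needed: those of `G_1` are real, hence negative, so each comes from a
zero of `J_1`; and there are infinitely many, so that the recursive infima in `besselZero` are
attained. -/

/-! ### The entire functions `G_ν`: derivatives, recurrence and growth -/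

/-- The entire function `G_ν(z) = ∑ z ^ k / (k! (k + ν)!)`, so that
`I_ν(z) = (z / 2) ^ ν * G_ν(z ^ 2 / 4)` and `J_ν(z) = (z / 2) ^ ν * G_ν(-z ^ 2 / 4)`. -/
noncomputable def besselSeries (ν : ℕ) (z : ℂ) : ℂ :=
  ∑' k : ℕ, z ^ k / ((k ! : ℂ) * ((k + ν)! : ℂ))

theorem norm_besselSeries_term_le (ν : ℕ) (z : ℂ) (k : ℕ) :
    ‖z ^ k / ((k ! : ℂ) * ((k + ν)! : ℂ))‖ ≤ ‖z‖ ^ k / (k ! : ℝ) := by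
  rw [norm_div, norm_mul, norm_pow, Complex.norm_natCast, Complex.norm_natCast]
  gcongr
  have h1 : (1 : ℝ) ≤ ((k + ν)! : ℝ) := by exact_mod_cast Nat.succ_le_of_lt (Nat.factorial_pos _)
  nlinarith [(Nat.cast_nonneg (k !) : (0 : ℝ) ≤ (k ! : ℝ))]

theorem summable_besselSeries (ν : ℕ) (z : ℂ) :
    Summable fun k : ℕ => z ^ k / ((k ! : ℂ) * ((k + ν)! : ℂ)) :=
  .of_norm_bounded (Real.summable_pow_div_factorial ‖z‖) (norm_besselSeries_term_le ν z)

theorem hasDerivAt_besselSeries (ν : ℕ) (z : ℂ) :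
    HasDerivAt (besselSeries ν) (besselSeries (ν + 1) z) z := by
  have hz : z ∈ Metric.ball (0 : ℂ) (‖z‖ + 1) := by simp
  have hu : Summable fun n : ℕ => (n : ℝ) * (‖z‖ + 1) ^ (n - 1) / (n ! : ℝ) := by
    rw [← summable_nat_add_iff 1]
    refine (Real.summable_pow_div_factorial (‖z‖ + 1)).congr fun n => ?_
    rw [Nat.factorial_succ]
    push_cast
    field_simp
  have key : ∀ (n : ℕ) (y : ℂ), y ∈ Metric.ball (0 : ℂ) (‖z‖ + 1) →
      ‖(n : ℂ) * y ^ (n - 1) / ((n ! : ℂ) * ((n + ν)! : ℂ))‖ ≤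
        (n : ℝ) * (‖z‖ + 1) ^ (n - 1) / (n ! : ℝ) := by
    intro n y hy
    rw [norm_div, norm_mul, norm_mul, norm_pow, Complex.norm_natCast, Complex.norm_natCast,
      Complex.norm_natCast]
    have hy' : ‖y‖ ≤ ‖z‖ + 1 := by simpa using (mem_ball_zero_iff.1 hy).le
    gcongr
    have h1 : (1 : ℝ) ≤ ((n + ν)! : ℝ) := by
      exact_mod_cast Nat.succ_le_of_lt (Nat.factorial_pos _)
    nlinarith [(Nat.cast_nonneg (n !) : (0 : ℝ) ≤ (n ! : ℝ))]
  have h := hasDerivAt_tsum_of_isPreconnected hu Metric.isOpen_ball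
    (convex_ball (0 : ℂ) (‖z‖ + 1)).isPreconnected
    (g := fun (n : ℕ) y => y ^ n / ((n ! : ℂ) * ((n + ν)! : ℂ)))
    (fun n y _ => (hasDerivAt_pow n y).div_const _) key hz (summable_besselSeries ν z) hz
  refine h.congr_deriv ?_
  rw [Summable.tsum_eq_zero_add (.of_norm_bounded hu fun n => key n z hz)]
  simp only [Nat.cast_zero, zero_mul, zero_div, zero_add]
  refine tsum_congr fun n => ?_
  rw [Nat.factorial_succ n, show n + 1 + ν = n + (ν + 1) by ring]
  have : ((n + 1 : ℕ) : ℂ) ≠ 0 := Nat.cast_ne_zero.2 n.succ_ne_zero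
  push_cast at this ⊢
  field_simp

theorem differentiable_besselSeries (ν : ℕ) : Differentiable ℂ (besselSeries ν) :=
  fun z => (hasDerivAt_besselSeries ν z).differentiableAt

theorem deriv_besselSeries (ν : ℕ) : deriv (besselSeries ν) = besselSeries (ν + 1) :=
  funext fun z => (hasDerivAt_besselSeries ν z).deriv

theorem iteratedDeriv_besselSeries (ν n : ℕ) :
    iteratedDeriv n (besselSeries ν) = besselSeries (ν + n) := by
  induction n with
  | zero => simp
  | succ n ih => rw [iteratedDeriv_succ, ih, deriv_besselSeries, add_assoc]

theorem besselSeries_zero_right (ν : ℕ) : besselSeries ν 0 = 1 / (ν ! : ℂ) := by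
  rw [besselSeries, tsum_eq_single 0 fun k hk => by simp [hk]]
  simp

/-- Bessel's equation in disguise, because `G_ν' = G_{ν+1}`. On coefficients it is `k + (ν + 1) = k
+ ν + 1`, cancelled against `(k + ν + 1)!`. -/
theorem besselSeries_recurrence (ν : ℕ) (z : ℂ) :
    z * besselSeries (ν + 2) z + (ν + 1) * besselSeries (ν + 1) z = besselSeries ν z := by
  have hs : Summable fun k : ℕ => (k : ℂ) * (z ^ k / ((k ! : ℂ) * ((k + (ν + 1))! : ℂ))) := by
    rw [← summable_nat_add_iff 1]
    refine ((summable_besselSeries (ν + 2) z).mul_left z).congr fun n => ?_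
    rw [Nat.factorial_succ n, show n + 1 + (ν + 1) = n + (ν + 2) by ring]
    have : ((n + 1 : ℕ) : ℂ) ≠ 0 := Nat.cast_ne_zero.2 n.succ_ne_zero
    push_cast at this ⊢
    field_simp
    ring
  have h1 : z * besselSeries (ν + 2) z =
      ∑' k : ℕ, (k : ℂ) * (z ^ k / ((k ! : ℂ) * ((k + (ν + 1))! : ℂ))) := by
    rw [hs.tsum_eq_zero_add, besselSeries, ← tsum_mul_left]
    simp only [Nat.cast_zero, zero_mul, zero_add]
    refine tsum_congr fun n => ?_
    rw [Nat.factorial_succ n, show n + 1 + (ν + 1) = n + (ν + 2) by ring]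
    have : ((n + 1 : ℕ) : ℂ) ≠ 0 := Nat.cast_ne_zero.2 n.succ_ne_zero
    push_cast at this ⊢
    field_simp
    ring
  rw [h1, besselSeries, ← tsum_mul_left,
    ← hs.tsum_add ((summable_besselSeries (ν + 1) z).mul_left _), besselSeries]
  refine tsum_congr fun k => ?_
  rw [show k + (ν + 1) = (k + ν) + 1 by ring, Nat.factorial_succ (k + ν)]
  have : ((k + ν + 1 : ℕ) : ℂ) ≠ 0 := Nat.cast_ne_zero.2 (k + ν).succ_ne_zero
  push_cast at this ⊢
  field_simp
  ring

theorem besselSeries_ofReal (ν : ℕ) (x : ℝ) :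
    besselSeries ν x = ((∑' k : ℕ, x ^ k / ((k ! : ℝ) * ((k + ν)! : ℝ)) : ℝ) : ℂ) := by
  rw [besselSeries, Complex.ofReal_tsum]
  exact tsum_congr fun k => by push_cast; rfl

theorem summable_besselSeries_real (ν : ℕ) (x : ℝ) :
    Summable fun k : ℕ => x ^ k / ((k ! : ℝ) * ((k + ν)! : ℝ)) := by
  have := summable_besselSeries ν x
  rw [← Complex.summable_ofReal]
  exact this.congr fun k => by push_cast; rfl

/-- With `s = √‖z‖` the terms are at most `(s^k / k!)²`; one factor is bounded by `exp s`, the other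
sums to `exp s`. Growth of order `1/2` is what makes the later error terms vanish. -/
theorem norm_besselSeries_le (ν : ℕ) (z : ℂ) :
    ‖besselSeries ν z‖ ≤ Real.exp (2 * √‖z‖) := by
  set s := √‖z‖ with hs
  have hs0 : 0 ≤ s := Real.sqrt_nonneg _
  have hz : ‖z‖ = s ^ 2 := (Real.sq_sqrt (norm_nonneg z)).symm
  have hsum := Real.summable_pow_div_factorial s
  have hexp : ∑' n : ℕ, s ^ n / (n ! : ℝ) = Real.exp s := by
    rw [Real.exp_eq_exp_ℝ, NormedSpace.exp_eq_tsum_div]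
  refine tsum_of_norm_bounded (g := fun k : ℕ => s ^ k / (k ! : ℝ) * Real.exp s)
    (a := Real.exp (2 * s)) ?_ fun k => ?_
  · rw [two_mul, Real.exp_add]
    exact (hexp ▸ hsum.hasSum).mul_right _
  · have h1 : s ^ k / (k ! : ℝ) ≤ Real.exp s := by
      rw [← hexp]
      exact hsum.le_tsum k fun j _ => by positivity
    have h2 : (k ! : ℝ) ≤ ((k + ν)! : ℝ) := by exact_mod_cast Nat.factorial_le (by lia)
    calc ‖z ^ k / ((k ! : ℂ) * ((k + ν)! : ℂ))‖
        = (s ^ 2) ^ k / ((k ! : ℝ) * ((k + ν)! : ℝ)) := by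
          rw [norm_div, norm_mul, norm_pow, Complex.norm_natCast, Complex.norm_natCast, hz]
      _ ≤ (s ^ 2) ^ k / ((k ! : ℝ) * (k ! : ℝ)) := by gcongr
      _ = s ^ k / (k ! : ℝ) * (s ^ k / (k ! : ℝ)) := by rw [← pow_mul]; field_simp; ring
      _ ≤ s ^ k / (k ! : ℝ) * Real.exp s := by gcongr

theorem pow_div_le_norm_besselSeries (ν n : ℕ) {x : ℝ} (hx : 0 ≤ x) :
    x ^ n / ((n ! : ℝ) * ((n + ν)! : ℝ)) ≤ ‖besselSeries ν x‖ := by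
  rw [besselSeries_ofReal, Complex.norm_real]
  exact ((summable_besselSeries_real ν x).le_tsum n fun j _ => by positivity).trans
    (le_abs_self _)

theorem besselSeries_ne_zero_of_nonneg (ν : ℕ) {x : ℝ} (hx : 0 ≤ x) :
    besselSeries ν x ≠ 0 := by
  have h := pow_div_le_norm_besselSeries ν 0 hx
  have h0 : (0 : ℝ) < x ^ 0 / ((0 ! : ℝ) * ((0 + ν)! : ℝ)) := by
    simp only [pow_zero]; positivity
  exact norm_pos_iff.1 (h0.trans_le h)

/-! ### Zeros of `G_1`: simple, real, negative -/

/-- The zeros of `G_1` are simple: by the recurrence a double zero is a zero of all `G_n`. -/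
theorem besselSeries_two_ne_zero {z : ℂ} (hz : besselSeries 1 z = 0) : besselSeries 2 z ≠ 0 := by
  intro h2
  have hz0 : z ≠ 0 := fun h => besselSeries_ne_zero_of_nonneg 1 le_rfl (by simpa [h] using hz)
  have hall : ∀ n : ℕ, besselSeries (n + 1) z = 0 ∧ besselSeries (n + 2) z = 0 := by
    intro n
    induction n with
    | zero => exact ⟨hz, h2⟩
    | succ n ih =>
      refine ⟨ih.2, ?_⟩
      have h := besselSeries_recurrence (n + 1) z
      rw [show n + 1 + 1 = n + 2 from rfl, ih.1, ih.2, mul_zero, add_zero] at h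
      exact (mul_eq_zero.1 h).resolve_left hz0
  -- The Taylor series centred at the double zero `z`, evaluated at `0`: all its coefficients
  -- vanish, although `G_1(0) = 1`.
  have h := Complex.taylorSeries_eq_of_entire' z 0 (differentiable_besselSeries 1)
  simp only [iteratedDeriv_besselSeries, add_comm 1, (hall _).1, mul_zero, zero_mul,
    tsum_zero] at h
  exact besselSeries_ne_zero_of_nonneg 1 le_rfl (by simpa using h.symm)

/-- The zeros of `G_1` are real: along the segment from `0` to a zero `a`, the function
`u(t) = G_1(a t)` solves `(t² u')' = a t u`, so `t² Im (u' ū)` has derivative `t (Im a) |u|²`. -/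
theorem im_eq_zero_of_besselSeries_eq_zero {a : ℂ} (ha : besselSeries 1 a = 0) : a.im = 0 := by
  by_contra him
  set u : ℝ → ℂ := fun t => besselSeries 1 (t * a) with hu
  set v : ℝ → ℂ := fun t => besselSeries 2 (t * a) with hv
  set W : ℝ → ℂ := fun t => (t : ℂ) ^ 2 * a * v t with hW
  have hlin (t : ℝ) : HasDerivAt (fun t : ℝ => (t : ℂ) * a) a t := by
    simpa using (Complex.ofRealCLM.hasDerivAt (x := t)).mul_const a
  have hu' (t : ℝ) : HasDerivAt u (v t * a) t :=
    HasDerivAt.comp (h := fun t : ℝ => (t : ℂ) * a) t (hasDerivAt_besselSeries 1 _) (hlin t)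
  have hv' (t : ℝ) : HasDerivAt v (besselSeries 3 (t * a) * a) t :=
    HasDerivAt.comp (h := fun t : ℝ => (t : ℂ) * a) t (hasDerivAt_besselSeries 2 _) (hlin t)
  have hW' (t : ℝ) : HasDerivAt W (t * a * u t) t := by
    have h1 : HasDerivAt (fun t : ℝ => (t : ℂ) ^ 2 * a) (2 * t * a) t := by
      simpa using ((Complex.ofRealCLM.hasDerivAt (x := t)).pow 2).mul_const a
    refine (h1.mul (hv' t)).congr_deriv ?_
    have := besselSeries_recurrence 1 (t * a)
    simp only [hu, hv]
    rw [← this]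
    push_cast
    ring
  set f : ℝ → ℝ := fun t => (W t * (starRingEnd ℂ) (u t)).im with hf
  have hf' (t : ℝ) : HasDerivAt f (t * a.im * Complex.normSq (u t)) t := by
    have h2 : HasDerivAt (fun t => (starRingEnd ℂ) (u t)) ((starRingEnd ℂ) (v t * a)) t :=
      (hu' t).star
    have h3 := Complex.imCLM.hasFDerivAt.comp_hasDerivAt t ((hW' t).mul h2)
    refine h3.congr_deriv ?_
    -- The product rule yields `t a |u|² + t² |u'|²`, whose second summand is real.
    have e1 : (t : ℂ) * a * u t * (starRingEnd ℂ) (u t) + W t * (starRingEnd ℂ) (v t * a)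
        = t * a * (Complex.normSq (u t) : ℝ) + ((t ^ 2 * Complex.normSq (v t * a) : ℝ) : ℂ) := by
      push_cast
      rw [← Complex.mul_conj, ← Complex.mul_conj]
      simp only [hW]
      ring
    rw [Complex.imCLM_apply, e1, Complex.add_im, Complex.ofReal_im, add_zero, Complex.im_mul_ofReal,
      Complex.im_ofReal_mul]
  have hf0 : f 0 = 0 := by simp [hf, hW]
  have hf1 : f 1 = 0 := by simp [hf, hu, ha]
  -- the sign-normalised function is monotone with equal end values
  set g : ℝ → ℝ := fun t => a.im * f t with hg
  have hg' (t : ℝ) : HasDerivAt g (a.im * (t * a.im * Complex.normSq (u t))) t :=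
    (hf' t).const_mul _
  have hmono : MonotoneOn g (Set.Icc 0 1) := by
    refine monotoneOn_of_deriv_nonneg (convex_Icc 0 1)
      (fun t _ => (hg' t).continuousAt.continuousWithinAt)
      (fun t _ => (hg' t).differentiableAt.differentiableWithinAt) fun t ht => ?_
    rw [interior_Icc] at ht
    rw [(hg' t).deriv]
    have := Complex.normSq_nonneg (u t)
    have h4 : a.im * (t * a.im * Complex.normSq (u t)) =
      t * (a.im ^ 2 * Complex.normSq (u t)) := by ring
    rw [h4]
    exact mul_nonneg ht.1.le (by positivity)
  have hgz : ∀ t ∈ Set.Icc (0 : ℝ) 1, g t = 0 := fun t ht =>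
    le_antisymm
      ((hmono ht (Set.right_mem_Icc.2 zero_le_one) ht.2).trans_eq (by simp [hg, hf1]))
      (((by simp [hg, hf0] : (0 : ℝ) = g 0)).trans_le
        (hmono (Set.left_mem_Icc.2 zero_le_one) ht ht.1))
  -- `g` is constant, so `t (Im a)² |u|² = 0` and `u` vanishes on `(0, 1)`; by continuity `u(0) =
  -- 0`, contradicting `G_1(0) ≠ 0`.
  have huz : ∀ t ∈ Set.Ioo (0 : ℝ) 1, u t = 0 := by
    intro t ht
    have h5 : g =ᶠ[𝓝 t] fun _ => 0 := by
      filter_upwards [Ioo_mem_nhds ht.1 ht.2] with s hs using hgz s ⟨hs.1.le, hs.2.le⟩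
    have h6 := (hg' t).unique ((hasDerivAt_const t (0 : ℝ)).congr_of_eventuallyEq h5)
    simpa [him, ht.1.ne'] using h6
  have hu0 : u 0 = 0 := by
    have hcl : (0 : ℝ) ∈ closure (Set.Ioo (0 : ℝ) 1) := by
      rw [closure_Ioo zero_ne_one]; exact Set.left_mem_Icc.2 zero_le_one
    have hcont : Continuous u := continuous_iff_continuousAt.2 fun t => (hu' t).continuousAt
    exact closure_minimal huz (isClosed_singleton.preimage hcont) hcl
  exact besselSeries_ne_zero_of_nonneg 1 le_rfl (by simpa [hu] using hu0)

theorem exists_pos_of_besselSeries_eq_zero {a : ℂ} (ha : besselSeries 1 a = 0) :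
    ∃ x : ℝ, 0 < x ∧ a = -((x ^ 2 / 4 : ℝ) : ℂ) := by
  have hre : a = (a.re : ℂ) := by
    apply Complex.ext <;> simp [im_eq_zero_of_besselSeries_eq_zero ha]
  have hneg : a.re < 0 := by
    by_contra! h
    exact besselSeries_ne_zero_of_nonneg 1 h (hre ▸ ha)
  refine ⟨2 * √(-a.re), by have := Real.sqrt_pos.2 (neg_pos.2 hneg); positivity, ?_⟩
  rw [mul_pow, Real.sq_sqrt (by linarith)]
  rw [show -((2 ^ 2 * -a.re / 4 : ℝ) : ℂ) = (a.re : ℂ) by push_cast; ring]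
  exact hre

/-! ### Entire functions of small growth and their zeros -/

/-- A holomorphic function without zeros on a disc, normalised at the centre and bounded by
`exp A`, has there a logarithm satisfying the Borel–Carathéodory bound. -/
theorem exists_log_norm_le {Q : ℂ → ℂ} {R A : ℝ} (hA : 0 < A) (hR : 0 < R)
    (hQ : Differentiable ℂ Q) (h1 : Q 0 = 1) (hne : ∀ z ∈ Metric.ball (0 : ℂ) R, Q z ≠ 0)
    (hb : ∀ z ∈ Metric.ball (0 : ℂ) R, ‖Q z‖ ≤ Real.exp A) :
    ∃ h : ℂ → ℂ, (∀ z ∈ Metric.ball (0 : ℂ) R, HasDerivAt h (logDeriv Q z) z) ∧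
      (∀ z ∈ Metric.ball (0 : ℂ) R, Complex.exp (h z) = Q z) ∧
      ∀ z ∈ Metric.ball (0 : ℂ) R, ‖h z‖ ≤ 2 * A * ‖z‖ / (R - ‖z‖) := by
  have hd : DifferentiableOn ℂ (logDeriv Q) (Metric.ball 0 R) := by
    have hQ' : Differentiable ℂ (deriv Q) := hQ.deriv
    exact hQ'.differentiableOn.div hQ.differentiableOn hne
  obtain ⟨h, h0, hh⟩ := hd.isExactOn_ball.with_val_at 0 0
  have h0mem : (0 : ℂ) ∈ Metric.ball (0 : ℂ) R := Metric.mem_ball_self hR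
  have hexp : ∀ z ∈ Metric.ball (0 : ℂ) R, Complex.exp (h z) = Q z := by
    have hder : ∀ z ∈ Metric.ball (0 : ℂ) R,
        HasDerivAt (fun z => Complex.exp (-h z) * Q z) 0 z := by
      intro z hz
      refine ((hh z hz).neg.cexp.mul (hQ z).hasDerivAt).congr_deriv ?_
      rw [logDeriv_apply]
      have := hne z hz
      field_simp
      ring
    intro z hz
    have hc := Metric.isOpen_ball.is_const_of_deriv_eq_zero
      (convex_ball (0 : ℂ) R).isPreconnected
      (fun w hw => (hder w hw).differentiableAt.differentiableWithinAt)
      (fun w hw => (hder w hw).deriv) hz h0mem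
    simp only [h0, neg_zero, Complex.exp_zero, one_mul, h1] at hc
    rw [Complex.exp_neg] at hc
    have := Complex.exp_ne_zero (h z)
    field_simp at hc
    exact hc.symm
  refine ⟨h, hh, hexp, fun z hz => ?_⟩
  -- As `|Q| = exp(Re h)`, the bound on `Q` says `Re h ≤ A`.
  refine Complex.borelCaratheodory_zero hA
    (fun w hw => (hh w hw).differentiableAt.differentiableWithinAt) (fun w hw => ?_) hR hz h0
  have h2 := hb w hw
  rw [← hexp w hw, Complex.norm_exp] at h2
  exact Real.exp_le_exp.1 h2

/-- Finitely many zeros of an entire function can be divided out. -/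
theorem exists_eq_prod_mul {f : ℂ → ℂ} (hf : Differentiable ℂ f) (S : Finset ℂ)
    (hS : ∀ a ∈ S, f a = 0 ∧ a ≠ 0) :
    ∃ Q : ℂ → ℂ, Differentiable ℂ Q ∧ ∀ z, f z = (∏ a ∈ S, (1 - z / a)) * Q z := by
  induction S using Finset.induction_on with
  | empty => exact ⟨f, hf, by simp⟩
  | insert b S hb ih =>
    obtain ⟨Q, hQ, hfQ⟩ := ih fun a ha => hS a (Finset.mem_insert_of_mem ha)
    obtain ⟨hfb, hb0⟩ := hS b (Finset.mem_insert_self b S)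
    have hQb : Q b = 0 := by
      rw [hfQ b] at hfb
      refine (mul_eq_zero.1 hfb).resolve_left (Finset.prod_ne_zero_iff.2 fun a ha => ?_)
      have ha0 := (hS a (Finset.mem_insert_of_mem ha)).2
      rw [sub_ne_zero, ne_comm, Ne, div_eq_one_iff_eq ha0]
      rintro rfl
      exact hb ha
    -- `Q(z) = (z - b) · dslope Q b z`, and `z - b = (1 - z / b)(-b)`.
    refine ⟨fun z => -b * dslope Q b z, ?_, fun z => ?_⟩
    · have : DifferentiableOn ℂ (dslope Q b) Set.univ :=
        (Complex.differentiableOn_dslope univ_mem).2 hQ.differentiableOn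
      exact (differentiableOn_univ.1 this).const_mul _
    · have h1 := sub_smul_dslope Q b z
      rw [hQb, sub_zero, smul_eq_mul] at h1
      rw [Finset.prod_insert hb, hfQ z, ← h1]
      field_simp
      ring

/-- After division by all zeros in a disc of radius `R` (assumed simple and different from `0`),
an entire function with `f 0 = 1` has no zeros there and is bounded by its maximum on the circle
of radius `2 R`. -/
theorem exists_zeroFree_factor {f : ℂ → ℂ} (hf : Differentiable ℂ f) (hf0 : f 0 = 1)
    (hsimple : ∀ a, f a = 0 → deriv f a ≠ 0) {R A : ℝ} (hR : 0 < R)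
    (hbound : ∀ z : ℂ, ‖z‖ = 2 * R → ‖f z‖ ≤ Real.exp A) (S : Finset ℂ)
    (hS : ∀ a, a ∈ S ↔ f a = 0 ∧ ‖a‖ < R) :
    ∃ Q : ℂ → ℂ, Differentiable ℂ Q ∧ (∀ z, f z = (∏ a ∈ S, (1 - z / a)) * Q z) ∧ Q 0 = 1 ∧
      (∀ z ∈ Metric.ball (0 : ℂ) R, Q z ≠ 0) ∧
      ∀ z ∈ Metric.ball (0 : ℂ) R, ‖Q z‖ ≤ Real.exp A := by
  have hS0 : ∀ a ∈ S, a ≠ 0 := by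
    rintro a ha rfl
    simpa [hf0] using ((hS 0).1 ha).1
  obtain ⟨Q, hQ, hfQ⟩ := exists_eq_prod_mul hf S fun a ha => ⟨((hS a).1 ha).1, hS0 a ha⟩
  refine ⟨Q, hQ, hfQ, ?_, fun z hz hQz => ?_, fun z hz => ?_⟩
  · simpa [hf0] using (hfQ 0).symm
  -- A zero of `Q` in the disc is also a zero of the product, hence a double zero of `f`.
  · have hfz : f z = 0 := by rw [hfQ, hQz, mul_zero]
    have hzS : z ∈ S := (hS z).2 ⟨hfz, by simpa using hz⟩
    have hP : (∏ a ∈ S, (1 - z / a)) = 0 :=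
      Finset.prod_eq_zero hzS (by rw [div_self (hS0 z hzS), sub_self])
    have hPd : Differentiable ℂ fun z : ℂ => ∏ a ∈ S, (1 - z / a) := by fun_prop
    have h1 := (hPd z).hasDerivAt.mul (hQ z).hasDerivAt
    have h2 : f = (fun z : ℂ => ∏ a ∈ S, (1 - z / a)) * Q := funext hfQ
    rw [← h2, hQz, hP, mul_zero, zero_mul, add_zero] at h1
    exact hsimple z hfz h1.deriv
  -- Maximum principle: on `|w| = 2R` each factor satisfies `|1 - w/a| ≥ |w/a| - 1 ≥ 1`, so `|Q| ≤
  -- |f|` there.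
  · refine Complex.norm_le_of_forall_mem_frontier_norm_le (U := Metric.ball (0 : ℂ) (2 * R))
      Metric.isBounded_ball hQ.diffContOnCl (fun w hw => ?_) (subset_closure ?_)
    · rw [frontier_ball _ (by positivity), mem_sphere_zero_iff_norm] at hw
      refine le_trans ?_ (hbound w hw)
      rw [hfQ w, norm_mul, norm_prod]
      refine le_mul_of_one_le_left (norm_nonneg _) ?_
      rw [← Finset.prod_const_one (s := S)]
      refine Finset.prod_le_prod (fun _ _ => zero_le_one) fun a ha => ?_
      have ha0 : 0 < ‖a‖ := norm_pos_iff.2 (hS0 a ha)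
      have h3 : 2 ≤ ‖w / a‖ := by
        rw [norm_div, hw, le_div_iff₀ ha0]
        have := ((hS a).1 ha).2
        linarith
      have h4 := norm_sub_norm_le (w / a) 1
      rw [norm_one, norm_sub_rev] at h4
      linarith
    · rw [mem_ball_zero_iff] at hz ⊢
      linarith

theorem logDeriv_one_sub_div {a : ℂ} (ha : a ≠ 0) (z : ℂ) :
    logDeriv (fun z : ℂ => 1 - z / a) z = (z - a)⁻¹ := by
  have h : HasDerivAt (fun z : ℂ => 1 - z / a) (-(1 / a)) z :=
    ((hasDerivAt_id z).div_const a).const_sub 1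
  rw [logDeriv_apply, h.deriv, one_sub_div ha, ← neg_div, div_div_div_cancel_right₀ ha,
    ← neg_sub z a, neg_div_neg_eq, one_div]

theorem iteratedDeriv_inv_sub_const (k : ℕ) (a : ℂ) :
    iteratedDeriv k (fun z : ℂ => (z - a)⁻¹) 0 = -((k ! : ℂ) * (a ^ (k + 1))⁻¹) := by
  have h := congrFun (iter_deriv_inv_linear_sub k (1 : ℂ) a) 0
  simp only [one_mul, one_pow, mul_one, zero_sub] at h
  rw [iteratedDeriv_eq_iterate, h, show (-1 - k : ℤ) = -((k + 1 : ℕ) : ℤ) by push_cast; ring,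
    zpow_neg, zpow_natCast, neg_pow a, mul_inv, ← inv_pow, inv_neg_one, pow_succ (-1 : ℂ)]
  have : ((-1 : ℂ) ^ k) * (-1) ^ k = 1 := by rw [← mul_pow]; simp
  linear_combination (-(k ! : ℂ) * (a ^ (k + 1))⁻¹) * this

/-- Quantitative form of the formula for the power sums of reciprocal zeros. -/
theorem norm_sum_inv_pow_add_le {f : ℂ → ℂ} (hf : Differentiable ℂ f) (hf0 : f 0 = 1)
    (hsimple : ∀ a, f a = 0 → deriv f a ≠ 0) {R A : ℝ} (hA : 0 < A) (hR : 0 < R)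
    (hbound : ∀ z : ℂ, ‖z‖ = 2 * R → ‖f z‖ ≤ Real.exp A) (S : Finset ℂ)
    (hS : ∀ a, a ∈ S ↔ f a = 0 ∧ ‖a‖ < R) (k : ℕ) :
    ‖(k ! : ℂ) * ∑ a ∈ S, (a ^ (k + 1))⁻¹ + iteratedDeriv k (logDeriv f) 0‖ ≤
      (k + 1)! * (2 * A) / (R / 2) ^ (k + 1) := by
  obtain ⟨Q, hQ, hfQ, hQ0, hQne, hQb⟩ := exists_zeroFree_factor hf hf0 hsimple hR hbound S hS
  obtain ⟨h, hh, -, hhb⟩ := exists_log_norm_le hA hR hQ hQ0 hQne hQb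
  have hS0 : ∀ a ∈ S, a ≠ 0 := by
    rintro a ha rfl
    simpa [hf0] using ((hS 0).1 ha).1
  have hball : Metric.ball (0 : ℂ) R ∈ 𝓝 (0 : ℂ) := Metric.ball_mem_nhds 0 hR
  have hev : logDeriv f =ᶠ[𝓝 0] fun z => (∑ a ∈ S, (z - a)⁻¹) + deriv h z := by
    have hne : ∀ᶠ z in 𝓝 (0 : ℂ), f z ≠ 0 :=
      hf.continuous.continuousAt.eventually_ne (by simp [hf0])
    filter_upwards [hne, hball] with z hz hzR
    rw [hfQ z] at hz
    have hP := Finset.prod_ne_zero_iff.1 (left_ne_zero_of_mul hz)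
    have h2 : f = fun z => (∏ a ∈ S, (1 - z / a)) * Q z := funext hfQ
    rw [h2, logDeriv_mul z (left_ne_zero_of_mul hz) (right_ne_zero_of_mul hz)
      (by fun_prop) (hQ z), logDeriv_prod hP (by fun_prop), (hh z hzR).deriv]
    exact congrArg (· + _) (Finset.sum_congr rfl fun a ha => logDeriv_one_sub_div (hS0 a ha) z)
  have hhd : DifferentiableOn ℂ h (Metric.ball 0 R) :=
    fun z hz => (hh z hz).differentiableAt.differentiableWithinAt
  have hha : AnalyticAt ℂ h 0 := hhd.analyticAt hball
  have hinv : ∀ a ∈ S, ContDiffAt ℂ k (fun z : ℂ => (z - a)⁻¹) 0 := fun a ha =>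
    (contDiffAt_id.sub contDiffAt_const).inv (by simpa using hS0 a ha)
  have hcomp : iteratedDeriv k (logDeriv f) 0 =
      -((k ! : ℂ) * ∑ a ∈ S, (a ^ (k + 1))⁻¹) + iteratedDeriv (k + 1) h 0 := by
    rw [hev.iteratedDeriv_eq, iteratedDeriv_fun_add (ContDiffAt.sum hinv) hha.deriv.contDiffAt,
      iteratedDeriv_fun_sum hinv, iteratedDeriv_succ']
    simp only [iteratedDeriv_inv_sub_const, Finset.sum_neg_distrib, Finset.mul_sum]
  rw [hcomp, add_neg_cancel_left]
  -- Cauchy's estimate on `|z| = R/2`, where Borel–Carathéodory gives exactly `|h| ≤ 2A`.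
  refine Complex.norm_iteratedDeriv_le_of_forall_mem_sphere_norm_le (k + 1) (half_pos hR)
    (DifferentiableOn.diffContOnCl (hhd.mono ?_)) fun z hz => ?_
  · rw [closure_ball _ (half_pos hR).ne']
    exact Metric.closedBall_subset_ball (half_lt_self hR)
  · rw [mem_sphere_zero_iff_norm] at hz
    refine (hhb z (by rw [mem_ball_zero_iff]; linarith)).trans_eq ?_
    rw [hz]
    field_simp
    ring

/-- An entire function of order at most `1/2` with finitely many zeros, all simple, is a
polynomial. -/
theorem eq_prod_of_finite_zeros {f : ℂ → ℂ} (hf : Differentiable ℂ f) (hf0 : f 0 = 1)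
    (hsimple : ∀ a, f a = 0 → deriv f a ≠ 0) (hbound : ∀ z, ‖f z‖ ≤ Real.exp (2 * √‖z‖))
    (S : Finset ℂ) (hS : ∀ a, a ∈ S ↔ f a = 0) (z : ℂ) : f z = ∏ a ∈ S, (1 - z / a) := by
  have hS0 : ∀ a ∈ S, a ≠ 0 := by
    rintro a ha rfl
    simpa [hf0] using (hS 0).1 ha
  obtain ⟨Q, -, hfQ⟩ := exists_eq_prod_mul hf S fun a ha => ⟨(hS a).1 ha, hS0 a ha⟩
  set P := ∏ a ∈ S, (1 - z / a) with hP
  rcases eq_or_ne P 0 with hP0 | hP0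
  · rw [hfQ z, ← hP, hP0, zero_mul]
  suffices h : ‖f z / P - 1‖ ≤ 0 by
    rw [norm_le_zero_iff, sub_eq_zero, div_eq_one_iff_eq hP0] at h
    exact h
  have hlim : Tendsto (fun s : ℝ => 2 * (8 * ‖z‖ / s)) atTop (𝓝 0) := by
    simpa using ((tendsto_const_nhds (x := 8 * ‖z‖)).div_atTop
      (tendsto_id (α := ℝ))).const_mul 2
  refine ge_of_tendsto hlim ?_
  have hlarge : ∀ᶠ s : ℝ in atTop, ∀ a ∈ S, ‖a‖ < s := by
    rw [eventually_all_finset]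
    exact fun a _ => eventually_gt_atTop _
  filter_upwards [hlarge, eventually_ge_atTop 1, eventually_gt_atTop ‖z‖,
    eventually_ge_atTop (8 * ‖z‖)] with s hsS hs1 hsz hsz8
  have hss : s ≤ s ^ 2 := by nlinarith
  have hsqrt : √(2 * (2 * s ^ 2)) = 2 * s := by
    rw [show 2 * (2 * s ^ 2) = (2 * s) ^ 2 by ring, Real.sqrt_sq (by positivity)]
  -- On the circle of radius `4s²` the growth bound is `exp(4s)`. Hence `|h(z)| ≤ 8s|z| / (2s² -
  -- |z|) ≤ 8|z|/s`, which tends to `0`; the condition `s ≥ 8|z|` keeps it at most `1`, so that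
  -- `|exp h - 1| ≤ 2|h|`.
  obtain ⟨q, hq, hfq, hq0, hqne, hqb⟩ := exists_zeroFree_factor hf hf0 hsimple
    (R := 2 * s ^ 2) (A := 4 * s) (by positivity)
    (fun w hw => (hbound w).trans_eq (by rw [hw, hsqrt]; ring_nf)) S fun a =>
      ⟨fun ha => ⟨(hS a).1 ha, (hsS a ha).trans_le (by nlinarith)⟩, fun ha => (hS a).2 ha.1⟩
  obtain ⟨h, -, hexp, hhb⟩ := exists_log_norm_le (by positivity) (by positivity) hq hq0 hqne hqb
  have hzb : z ∈ Metric.ball (0 : ℂ) (2 * s ^ 2) := by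
    rw [mem_ball_zero_iff]
    nlinarith
  have hh : ‖h z‖ ≤ 8 * ‖z‖ / s := by
    refine (hhb z hzb).trans ?_
    rw [div_le_div_iff₀ (by nlinarith) (by positivity)]
    nlinarith [mul_nonneg (norm_nonneg z) (show 0 ≤ s ^ 2 - ‖z‖ by linarith)]
  have hdiv : f z / P = Complex.exp (h z) := by
    rw [hexp z hzb, div_eq_iff hP0, hfq z, mul_comm]
  rw [hdiv]
  refine (Complex.norm_exp_sub_one_le (hh.trans ?_)).trans (by gcongr)
  rw [div_le_one (by positivity)]
  exact hsz8

/-! ### Bessel functions and `benderFun` in terms of `G_ν` -/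

theorem besselI_zero_two_mul (w : ℂ) : besselI 0 (2 * w) = besselSeries 0 (w ^ 2) := by
  rw [besselI, besselSeries]
  refine tsum_congr fun k => ?_
  rw [mul_div_cancel_left₀ w two_ne_zero, add_zero, add_zero, pow_mul]
  ring

theorem besselI_one_two_mul (w : ℂ) : besselI 1 (2 * w) = w * besselSeries 1 (w ^ 2) := by
  rw [besselI, besselSeries, ← tsum_mul_left]
  refine tsum_congr fun k => ?_
  rw [mul_div_cancel_left₀ w two_ne_zero, pow_succ, pow_mul]
  ring

theorem ofReal_besselJ_one (x : ℝ) :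
    (besselJ 1 x : ℂ) = x / 2 * besselSeries 1 (-((x ^ 2 / 4 : ℝ) : ℂ)) := by
  rw [besselJ, besselSeries, Complex.ofReal_tsum, ← tsum_mul_left]
  refine tsum_congr fun k => ?_
  push_cast
  rw [pow_succ (x / 2 : ℂ), pow_mul, neg_pow (x ^ 2 / 4 : ℂ),
    show (x / 2 : ℂ) ^ 2 = x ^ 2 / 4 by ring]
  ring

theorem besselJ_one_eq_zero_iff {x : ℝ} (hx : 0 < x) :
    besselJ 1 x = 0 ↔ besselSeries 1 (-((x ^ 2 / 4 : ℝ) : ℂ)) = 0 := by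
  rw [← Complex.ofReal_eq_zero, ofReal_besselJ_one, mul_eq_zero, or_iff_right]
  simpa using hx.ne'

theorem besselSeries_one_zero : besselSeries 1 0 = 1 := by
  simp [besselSeries_zero_right]

theorem deriv_besselSeries_one_ne_zero (a : ℂ) (ha : besselSeries 1 a = 0) :
    deriv (besselSeries 1) a ≠ 0 := by
  rw [deriv_besselSeries]
  exact besselSeries_two_ne_zero ha

/-- The quotient `√x I₀(2√x) / I₁(2√x)` is `G_0/G_1`, and the recurrence at `ν = 0` makes this `1 +
x G_1'/G_1`. -/
theorem benderFun_eventuallyEq :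
    benderFun =ᶠ[𝓝 0] fun x => x * (-1 + x * logDeriv (besselSeries 1) x) := by
  have hne : ∀ᶠ x in 𝓝 (0 : ℂ), besselSeries 1 x ≠ 0 :=
    (differentiable_besselSeries 1).continuous.continuousAt.eventually_ne
      (by simp [besselSeries_one_zero])
  filter_upwards [hne] with x hx
  rcases eq_or_ne x 0 with rfl | hx0
  · simp [benderFun]
  have hw0 : x ^ (1 / 2 : ℂ) ≠ 0 := by simp [Complex.cpow_eq_zero_iff, hx0]
  have hw2 : (x ^ (1 / 2 : ℂ)) ^ 2 = x := by simp
  rw [benderFun, besselI_zero_two_mul, besselI_one_two_mul, hw2, mul_div_mul_left _ _ hw0,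
    ← besselSeries_recurrence 0 x, logDeriv_apply, deriv_besselSeries]
  field_simp
  push_cast
  ring

/-! ### Counting and enumerating the zeros of `J_1` -/

theorem finite_zeros_besselSeries_one (B : ℝ) :
    {a : ℂ | besselSeries 1 a = 0 ∧ ‖a‖ ≤ B}.Finite := by
  by_contra hinf
  obtain ⟨c, -, hc⟩ := Set.Infinite.exists_accPt_of_subset_isCompact hinf
    (isCompact_closedBall (0 : ℂ) B) fun a ha => by simpa using ha.2
  have hfr := (accPt_iff_frequently_nhdsNE.1 hc).mono fun a ha => ha.1
  have han : AnalyticOnNhd ℂ (besselSeries 1) Set.univ :=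
    (differentiable_besselSeries 1).differentiableOn.analyticOnNhd isOpen_univ
  have h := congrFun (han.eq_of_frequently_eq (g := fun _ => 0) (fun _ _ => analyticAt_const) hfr) 0
  exact one_ne_zero (besselSeries_one_zero.symm.trans h)

/-- With only `n` zeros `G_1` would be a polynomial of degree `n`, yet on the positive axis it
dominates a multiple of `x^(n+1)`. -/
theorem infinite_zeros_besselSeries_one : {a : ℂ | besselSeries 1 a = 0}.Infinite := by
  intro hfin
  have hprod := eq_prod_of_finite_zeros (differentiable_besselSeries 1) besselSeries_one_zero
    deriv_besselSeries_one_ne_zero (norm_besselSeries_le 1) hfin.toFinset (by simp)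
  set S := hfin.toFinset
  set n := S.card
  have hlim : Tendsto (fun x : ℝ => (∏ a ∈ S, ‖(x : ℂ)⁻¹ - a⁻¹‖) * x⁻¹) atTop (𝓝 0) := by
    have h1 : Tendsto (fun x : ℝ => (x : ℂ)⁻¹) atTop (𝓝 0) := by
      simpa [Function.comp_def] using
        (Complex.continuous_ofReal.tendsto 0).comp tendsto_inv_atTop_zero
    have h2 := (tendsto_finsetProd S fun a _ => (h1.sub_const a⁻¹).norm).mul
      tendsto_inv_atTop_zero
    simpa using h2
  have hpos : (0 : ℝ) < 1 / (((n + 1)! : ℝ) * ((n + 1 + 1)! : ℝ)) := by positivity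
  refine absurd (ge_of_tendsto hlim ?_) (not_le.2 hpos)
  filter_upwards [eventually_gt_atTop 0] with x hx
  have h3 := pow_div_le_norm_besselSeries 1 (n + 1) hx.le
  rw [hprod, norm_prod] at h3
  have h4 : ∏ a ∈ S, ‖1 - (x : ℂ) / a‖ = x ^ n * ∏ a ∈ S, ‖(x : ℂ)⁻¹ - a⁻¹‖ := by
    rw [← Finset.prod_const, ← Finset.prod_mul_distrib]
    refine Finset.prod_congr rfl fun a _ => ?_
    have hnx : ‖(x : ℂ)‖ = x := by rw [Complex.norm_real, Real.norm_of_nonneg hx.le]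
    nth_rewrite 2 [← hnx]
    rw [← norm_mul, mul_sub, mul_inv_cancel₀ (by simpa using hx.ne'), div_eq_mul_inv]
  rw [h4, pow_succ, mul_div_assoc] at h3
  have h5 := le_of_mul_le_mul_left h3 (pow_pos hx n)
  rw [← div_eq_mul_inv, le_div_iff₀ hx]
  calc _ = x / (((n + 1)! : ℝ) * ((n + 1 + 1)! : ℝ)) := by ring
    _ ≤ _ := h5

theorem finite_zeros_besselJ_one (B : ℝ) :
    {x : ℝ | 0 < x ∧ x ≤ B ∧ besselJ 1 x = 0}.Finite := by
  refine Set.Finite.of_finite_image (f := fun x : ℝ => -((x ^ 2 / 4 : ℝ) : ℂ))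
    ((finite_zeros_besselSeries_one (B ^ 2 / 4)).subset ?_) ?_
  · rintro _ ⟨x, ⟨hx, hxB, hJ⟩, rfl⟩
    refine ⟨(besselJ_one_eq_zero_iff hx).1 hJ, ?_⟩
    rw [norm_neg, Complex.norm_real, Real.norm_of_nonneg (by positivity)]
    gcongr
  · rintro x ⟨hx, -⟩ y ⟨hy, -⟩ hxy
    have h : x ^ 2 / 4 = y ^ 2 / 4 := Complex.ofReal_injective (neg_injective hxy)
    exact (sq_eq_sq₀ hx.le hy.le).1 (by linarith)

theorem exists_zero_besselJ_one_gt (y : ℝ) : ∃ x, y < x ∧ besselJ 1 x = 0 := by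
  by_contra! h
  refine infinite_zeros_besselSeries_one (((finite_zeros_besselJ_one y).image
    fun x : ℝ => -((x ^ 2 / 4 : ℝ) : ℂ)).subset fun a ha => ?_)
  obtain ⟨x, hx, rfl⟩ := exists_pos_of_besselSeries_eq_zero ha
  have hJ := (besselJ_one_eq_zero_iff hx).2 ha
  exact ⟨x, ⟨hx, not_lt.1 fun hyx => h x hyx hJ, hJ⟩, rfl⟩

/-- Further zeros exist and are locally finite, so the infimum is attained. Nonnegativity is carried
along because the finiteness lemma counts only positive zeros. -/
theorem isLeast_besselZero_one_succ (k : ℕ) :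
    IsLeast {x : ℝ | besselZero 1 k < x ∧ besselJ 1 x = 0} (besselZero 1 (k + 1)) ∧
      0 ≤ besselZero 1 k := by
  have key (k : ℕ) (hk : 0 ≤ besselZero 1 k) :
      IsLeast {x : ℝ | besselZero 1 k < x ∧ besselJ 1 x = 0} (besselZero 1 (k + 1)) := by
    obtain ⟨b, hb, hJb⟩ := exists_zero_besselJ_one_gt (besselZero 1 k)
    have hfin : {x : ℝ | besselZero 1 k < x ∧ x ≤ b ∧ besselJ 1 x = 0}.Finite :=
      (finite_zeros_besselJ_one b).subset fun x hx => ⟨hk.trans_lt hx.1, hx.2⟩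
    obtain ⟨m, hm⟩ := hfin.exists_minimal ⟨b, hb, le_rfl, hJb⟩
    have hleast : IsLeast {x : ℝ | besselZero 1 k < x ∧ besselJ 1 x = 0} m := by
      refine ⟨⟨hm.prop.1, hm.prop.2.2⟩, fun x hx => ?_⟩
      by_contra! hlt
      exact hlt.not_ge (hm.le_of_le ⟨hx.1, hlt.le.trans hm.prop.2.1, hx.2⟩ hlt.le)
    rw [besselZero, hleast.csInf_eq]
    exact hleast
  have hnonneg : ∀ k, 0 ≤ besselZero 1 k := by
    intro k
    induction k with
    | zero => rw [besselZero]
    | succ k ih => exact ih.trans (key k ih).1.1.le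
  exact ⟨key k (hnonneg k), hnonneg k⟩

theorem strictMono_besselZero_one : StrictMono (besselZero 1) :=
  strictMono_nat_of_lt_succ fun k => (isLeast_besselZero_one_succ k).1.1.1

theorem besselZero_one_pos (k : ℕ) : 0 < besselZero 1 (k + 1) :=
  (isLeast_besselZero_one_succ k).2.trans_lt (strictMono_besselZero_one k.lt_succ_self)

theorem tendsto_besselZero_one : Tendsto (fun k => besselZero 1 (k + 1)) atTop atTop := by
  refine tendsto_atTop_atTop_of_monotone
    (fun i j hij => strictMono_besselZero_one.monotone (by lia)) fun b => ?_
  by_contra! h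
  refine Set.infinite_range_of_injective (f := fun k => besselZero 1 (k + 1))
    (fun i j hij => by simpa using strictMono_besselZero_one.injective hij)
    ((finite_zeros_besselJ_one b).subset ?_)
  rintro _ ⟨k, rfl⟩
  exact ⟨besselZero_one_pos k, (h k).le, (isLeast_besselZero_one_succ k).1.1.2⟩

/-- Every positive zero of `J_1` below `j_{1,N+1}` is one of `j_{1,1}, …, j_{1,N}`. -/
theorem exists_eq_besselZero_one (N : ℕ) {x : ℝ} (hx : 0 < x) (hJ : besselJ 1 x = 0)
    (hlt : x < besselZero 1 (N + 1)) : ∃ n < N, besselZero 1 (n + 1) = x := by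
  have hle : ¬ besselZero 1 N < x := fun h =>
    hlt.not_ge ((isLeast_besselZero_one_succ N).1.2 ⟨h, hJ⟩)
  induction N with
  | zero => exact absurd (by rwa [besselZero]) hle
  | succ N ih =>
    rcases (not_lt.1 hle).lt_or_eq with h | h
    · obtain ⟨n, hn, hnx⟩ := ih h fun h' => h.not_ge ((isLeast_besselZero_one_succ N).1.2 ⟨h', hJ⟩)
      exact ⟨n, hn.trans N.lt_succ_self, hnx⟩
    · exact ⟨N, N.lt_succ_self, h.symm⟩

/-- The zeros of `G_1` in the disc of radius `j_{1,N+1} ^ 2 / 4` are `-j_{1,n} ^ 2 / 4`, `n ≤ N`. -/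
theorem mem_image_besselZero_one_iff (N : ℕ) (a : ℂ) :
    a ∈ (Finset.range N).image (fun n => -((besselZero 1 (n + 1) ^ 2 / 4 : ℝ) : ℂ)) ↔
      besselSeries 1 a = 0 ∧ ‖a‖ < besselZero 1 (N + 1) ^ 2 / 4 := by
  rw [Finset.mem_image]
  have hnorm (x : ℝ) : ‖-((x ^ 2 / 4 : ℝ) : ℂ)‖ = x ^ 2 / 4 := by
    rw [norm_neg, Complex.norm_real, Real.norm_of_nonneg (by positivity)]
  constructor
  · rintro ⟨n, hn, rfl⟩
    refine ⟨(besselJ_one_eq_zero_iff (besselZero_one_pos n)).1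
      (isLeast_besselZero_one_succ n).1.1.2, ?_⟩
    rw [hnorm]
    have h1 := besselZero_one_pos n
    have h2 : besselZero 1 (n + 1) < besselZero 1 (N + 1) :=
      strictMono_besselZero_one (by simpa using hn)
    gcongr
  · rintro ⟨ha, haN⟩
    obtain ⟨x, hx, rfl⟩ := exists_pos_of_besselSeries_eq_zero ha
    rw [hnorm] at haN
    have hlt : x < besselZero 1 (N + 1) :=
      lt_of_pow_lt_pow_left₀ 2 (besselZero_one_pos N).le (by linarith)
    obtain ⟨n, hn, rfl⟩ := exists_eq_besselZero_one N hx ((besselJ_one_eq_zero_iff hx).2 ha) hlt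
    exact ⟨n, Finset.mem_range.2 hn, rfl⟩

/-! ### Values of the Bessel zeta function -/

theorem tendsto_sum_inv_besselZero_one_pow (k : ℕ) :
    Tendsto (fun N => ((∑ n ∈ Finset.range N, 1 / besselZero 1 (n + 1) ^ (2 * (k + 1)) : ℝ) : ℂ))
      atTop (𝓝 (-(iteratedDeriv k (logDeriv (besselSeries 1)) 0 / ((k ! : ℂ) * (-4) ^ (k + 1))))) := by
  set D := iteratedDeriv k (logDeriv (besselSeries 1)) 0 with hD
  set s : ℕ → ℂ := fun N =>
    ((∑ n ∈ Finset.range N, 1 / besselZero 1 (n + 1) ^ (2 * (k + 1)) : ℝ) : ℂ) with hs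
  have hC : (k ! : ℂ) * (-4) ^ (k + 1) ≠ 0 :=
    mul_ne_zero (Nat.cast_ne_zero.2 k.factorial_ne_zero) (pow_ne_zero _ (by norm_num))
  have hbound : ∀ N, ‖((k ! : ℂ) * (-4) ^ (k + 1)) * s N + D‖ ≤
      (k + 1)! * 4 * 8 ^ (k + 1) * (besselZero 1 (N + 1) ^ (2 * k + 1))⁻¹ := by
    intro N
    have hy := besselZero_one_pos N
    set y := besselZero 1 (N + 1)
    -- On `|z| = 2R = y²/2` one has `2√|z| ≤ 2y`, whence `A = 2y`. The error is of order `A /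
    -- R^(k+1)`, that is `y^(-(2k+1))`.
    have h := norm_sum_inv_pow_add_le (differentiable_besselSeries 1) besselSeries_one_zero
      deriv_besselSeries_one_ne_zero (R := y ^ 2 / 4) (A := 2 * y) (by positivity) (by positivity)
      (fun z hz => (norm_besselSeries_le 1 z).trans (Real.exp_le_exp.2 ?_)) _
      (mem_image_besselZero_one_iff N) k
    · rw [Finset.sum_image] at h
      · convert! h using 1
        · simp only [hs]
          rw [mul_assoc, Complex.ofReal_sum, Finset.mul_sum]
          congr 3
          refine Finset.sum_congr rfl fun n _ => ?_
          push_cast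
          rw [show -((besselZero 1 (n + 1) : ℂ) ^ 2 / 4) = besselZero 1 (n + 1) ^ 2 * (-4)⁻¹ by ring,
            mul_pow, mul_inv, ← inv_pow (-4 : ℂ)⁻¹, inv_inv, ← pow_mul, one_div, mul_comm]
        · rw [div_div, div_pow, ← pow_mul, show 2 * (k + 1) = (2 * k + 1) + 1 by ring, pow_succ y]
          field_simp
          norm_num
          ring
      · rintro i - j - hij
        have h1 : besselZero 1 (i + 1) ^ 2 / 4 = besselZero 1 (j + 1) ^ 2 / 4 :=
          Complex.ofReal_injective (neg_injective hij)
        have h2 := (sq_eq_sq₀ (besselZero_one_pos i).le (besselZero_one_pos j).le).1 (by linarith)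
        simpa using strictMono_besselZero_one.injective h2
    · rw [hz]
      gcongr
      exact Real.sqrt_le_iff.2 ⟨hy.le, by nlinarith [sq_nonneg y]⟩
  have hlim : Tendsto (fun N => ((k ! : ℂ) * (-4) ^ (k + 1)) * s N + D) atTop (𝓝 0) := by
    refine squeeze_zero_norm hbound ?_
    have h1 : Tendsto (fun N => besselZero 1 (N + 1) ^ (2 * k + 1)) atTop atTop :=
      (tendsto_pow_atTop (by lia)).comp tendsto_besselZero_one
    simpa using h1.inv_tendsto_atTop.const_mul ((k + 1)! * 4 * 8 ^ (k + 1) : ℝ)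
  have h2 := (hlim.sub_const D).div_const ((k ! : ℂ) * (-4) ^ (k + 1))
  rw [zero_sub, neg_div] at h2
  refine h2.congr fun N => ?_
  rw [add_sub_cancel_right, mul_div_cancel_left₀ _ hC]

/-- The values of the Bessel zeta function at even integers in terms of the logarithmic derivative
of `G_1`. -/
theorem summable_and_besselZeta_eq (k : ℕ) :
    (Summable fun n : ℕ => 1 / besselZero 1 (n + 1) ^ (2 * ((k + 1 : ℕ) : ℝ))) ∧
      (besselZeta 1 (2 * ((k + 1 : ℕ) : ℝ)) : ℂ) =
        -(iteratedDeriv k (logDeriv (besselSeries 1)) 0 / ((k ! : ℂ) * (-4) ^ (k + 1))) := by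
  have hpow (n : ℕ) : 1 / besselZero 1 (n + 1) ^ (2 * ((k + 1 : ℕ) : ℝ)) =
      1 / besselZero 1 (n + 1) ^ (2 * (k + 1)) := by
    rw [← Real.rpow_natCast]
    push_cast
    rfl
  simp only [besselZeta, hpow]
  have hlim := tendsto_sum_inv_besselZero_one_pow k
  set c := -(iteratedDeriv k (logDeriv (besselSeries 1)) 0 / ((k ! : ℂ) * (-4) ^ (k + 1)))
  -- Real parts give real, nonnegative series, for which convergent partial sums imply summability;
  -- uniqueness of limits then shows that `c` is real.
  have hre := (Complex.continuous_re.tendsto c).comp hlim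
  have hsum : HasSum (fun n => 1 / besselZero 1 (n + 1) ^ (2 * (k + 1))) c.re := by
    rw [hasSum_iff_tendsto_nat_of_nonneg fun n => by have := besselZero_one_pos n; positivity]
    exact hre
  refine ⟨hsum.summable, ?_⟩
  rw [hsum.tsum_eq]
  exact tendsto_nhds_unique ((Complex.continuous_ofReal.tendsto c.re).comp hre) hlim

/-! ### Power series coefficients and the theorem -/

/-- The coefficients of `x (-1 + x G_1'(x) / G_1(x))`. -/
noncomputable def benderCoeff : ℕ → ℂ
  | 0 => 0
  | 1 => -1
  | k + 2 => iteratedDeriv k (logDeriv (besselSeries 1)) 0 / (k ! : ℂ)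

theorem isBenderExpansion_benderCoeff : IsBenderExpansion benderCoeff := by
  have hG := (differentiable_besselSeries 1).analyticAt 0
  have han : AnalyticAt ℂ (logDeriv (besselSeries 1)) 0 :=
    hG.deriv.div hG (by simp [besselSeries_one_zero])
  have hps := hasFPowerSeriesAt_iff.1 han.hasFPowerSeriesAt
  filter_upwards [hps, benderFun_eventuallyEq] with x hx hbx
  simp only [FormalMultilinearSeries.coeff_ofScalars, smul_eq_mul, zero_add] at hx
  rw [hbx, ← hasSum_nat_add_iff' 1]
  convert! hx.mul_left (x ^ 2) using 1
  · ext k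
    rw [benderCoeff]
    ring
  · simp only [Finset.sum_range_one, zero_add, benderCoeff]
    ring

/-- Uniqueness of power series; the unconstrained entry `a 0` is replaced by `0` first. -/
theorem IsBenderExpansion.eq {a b : ℕ → ℂ} (ha : IsBenderExpansion a) (hb : IsBenderExpansion b)
    (k : ℕ) : a (k + 1) = b (k + 1) := by
  have key {a : ℕ → ℂ} (ha : IsBenderExpansion a) : HasFPowerSeriesAt benderFun
      (FormalMultilinearSeries.ofScalars ℂ fun n => if n = 0 then (0 : ℂ) else a n) 0 := by
    rw [hasFPowerSeriesAt_iff]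
    filter_upwards [ha] with x hx
    rw [← hasSum_nat_add_iff' 1]
    simpa [FormalMultilinearSeries.coeff_ofScalars, mul_comm] using hx
  have h := congrArg (fun p => p.coeff (k + 1))
    ((key ha).eq_formalMultilinearSeries (key hb))
  simpa [FormalMultilinearSeries.coeff_ofScalars] using h

theorem mainTheorem8 :
    (∃ a : ℕ → ℂ, IsBenderExpansion a) ∧
    ∀ a : ℕ → ℂ, IsBenderExpansion a → ∀ k : ℕ, 1 ≤ k →
      Summable (fun n : ℕ => 1 / besselZero 1 (n + 1) ^ (2 * (k : ℝ))) ∧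
      benderM a k =
        (k ! : ℂ) * ((k + 1)! : ℂ) * 2 ^ (2 * k) * (besselZeta 1 (2 * (k : ℝ)) : ℂ) := by
  refine ⟨⟨_, isBenderExpansion_benderCoeff⟩, fun a ha k hk => ?_⟩
  obtain ⟨m, rfl⟩ := Nat.exists_eq_add_of_le' hk
  obtain ⟨hsum, hzeta⟩ := summable_and_besselZeta_eq m
  refine ⟨hsum, ?_⟩
  rw [hzeta, benderM, ha.eq isBenderExpansion_benderCoeff (m + 1)]
  have h4 : (-4 : ℂ) ^ (m + 1) = (-1) ^ (m + 1) * 2 ^ (2 * (m + 1)) := by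
    rw [pow_mul, ← mul_pow]; norm_num
  have h1 : ((-1 : ℂ) ^ (m + 1))⁻¹ = (-1) ^ (m + 1) := by rw [← inv_pow, inv_neg_one]
  have h2 : (2 : ℂ) ^ (2 * (m + 1)) ≠ 0 := pow_ne_zero _ two_ne_zero
  rw [h4, benderCoeff, pow_succ (-1 : ℂ) (m + 1), div_eq_mul_inv _ (_ * _), mul_inv, mul_inv, h1]
  field_simp
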